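/- Theorem (SCRiBLe Main). Let $n\ge 1$, $T\ge 2$, let $\mathcal K\subset\mathbb R^n$ be compact and convex with nonempty interior, and let $\mathcal R:\operatorname{int}\mathcal K\to\mathbb R$ be a $\vartheta$-self-concordant barrier on $\mathcal K$: $\vartheta\ge 0$, $\mathcal R$ is convex and $C^3$, $\mathcal R(x)\to\infty$ as $x\in\operatorname{int}\mathcal K$ tends to any point of $\partial\mathcal K$, and for all $x\in\operatorname{int}\mathcal K$, $h\in\mathbb R^n$, $$|D^3\mathcal R(x)[h,h,h]|\le 2\,(D^2\mathcal R(x)[h,h])^{3/2},\qquad |D\mathcal R(x)[h]|\le\sqrt{\vartheta\, D^2\mathcal R(x)[h,h]}.$$ Let $f_1,\dots,f_T\in\mathbb R^n$ be fixed in advance, and let $L>0$ satisfy $|f_t^{T}x|\le L$ for all $x\in\mathcal K$ and all $t$. Put $$\eta=\sqrt{\frac{\vartheta\log T}{2n^2L^2T}}.$$ SCRiBLe plays as follows in rounds $t=1,\dots,T$: 1. let $x_t=\operatorname{argmin}_{x\in\operatorname{int}\mathcal K}\bigl[\eta\sum_{s<t}\tilde f_s^{T}x+\mathcal R(x)\bigr]$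 (so $x_1$ minimizes $\mathcal R$); 2. let $e_1,\dots,e_n$ be an orthonormal basis of eigenvectors of $\nabla^2\mathcal R(x_t)$ with eigenvalues $\lambda_1,\dots,\lambda_n$, computed by an arbitrary fixed rule from $x_t$; 3. choose, independently of the past, $i$ uniform in $\{1,\dots,n\}$ and, independently, $\varepsilon$ uniform in $\{\pm1\}$; 4. predict $y_t=x_t+\varepsilon\lambda_i^{-1/2}e_i$ and observe the cost $f_t^{T}y_t$; 5. let $\tilde f_t=n\,(f_t^{T}y_t)\,\varepsilon\,\lambda_i^{1/2}e_i$. Suppose that $T/\log T>8\vartheta$. Then the algorithm is well defined (whatever the random choices, in each round the minimizer $x_t$ exists and is unique, all the eigenvalues $\lambda_i$ are positive, and $y_t\in\mathcal K$), and for every $u\in\mathcal K$ $$\mathbb E\Bigl[\sum_{t=1}^T f_t^{T}y_t-\sum_{t=1}^T f_t^{T}u\Bigr]\le nL\sqrt{8\vartheta T\log T}+2L .$$ -/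

import Mathlib

open scoped BigOperators Topology

noncomputable section

namespace Scrible

/-- Euclidean space `ℝⁿ`. -/
abbrev E (n : ℕ) : Type := EuclideanSpace ℝ (Fin n)

/-- `R` is a self-concordant function on the interior of `K`: it is convex and three times
continuously differentiable there, satisfies `|D³R(x)[h,h,h]| ≤ 2 (D²R(x)[h,h])^{3/2}`, and tends to
`+∞` at the boundary of `K`. The values of `R` outside `interior K` play no role (they stand for
`+∞`). -/
structure IsSelfConcordant {n : ℕ} (K : Set (E n)) (R : E n → ℝ) : Prop where
  contDiffOn : ContDiffOn ℝ 3 R (interior K)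
  convexOn : ConvexOn ℝ (interior K) R
  third_le : ∀ x ∈ interior K, ∀ h : E n,
    |iteratedFDeriv ℝ 3 R x ![h, h, h]| ≤ 2 * (iteratedFDeriv ℝ 2 R x ![h, h]) ^ (3 / 2 : ℝ)
  tendsto_frontier : ∀ z ∈ frontier K, Filter.Tendsto R (𝓝[interior K] z) Filter.atTop

/-- `R` is a `ϑ`-self-concordant barrier on `K`: moreover `|DR(x)[h]| ≤ √(ϑ D²R(x)[h,h])`. -/
structure IsSelfConcordantBarrier {n : ℕ} (ϑ : ℝ) (K : Set (E n)) (R : E n → ℝ) : Prop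
    extends IsSelfConcordant K R where
  nonneg : 0 ≤ ϑ
  first_le : ∀ x ∈ interior K, ∀ h : E n,
    |fderiv ℝ R x h| ≤ Real.sqrt (ϑ * iteratedFDeriv ℝ 2 R x ![h, h])

/-- The Hessian `∇²R(x)` as an operator: the derivative of the gradient. -/
def hessian {n : ℕ} (R : E n → ℝ) (x : E n) : E n →L[ℝ] E n :=
  fderiv ℝ (gradient R) x

/-- A rule that computes an eigendecomposition of the Hessian at each point of `interior K`:
orthonormal eigenvectors `e₁, …, eₙ` with eigenvalues `λ₁, …, λₙ`. -/
structure HessianEigen {n : ℕ} (K : Set (E n)) (R : E n → ℝ) where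
  vec : E n → OrthonormalBasis (Fin n) ℝ (E n)
  val : E n → Fin n → ℝ
  hessian_vec : ∀ x ∈ interior K, ∀ i, hessian R x (vec x i) = val x i • vec x i

/-- A minimizer of `g` over `S` (arbitrary if there is none). -/
def argminOn {n : ℕ} (S : Set (E n)) (g : E n → ℝ) : E n :=
  Classical.epsilon fun x => x ∈ S ∧ IsMinOn g S x

/-- The objective `η ⟨s, x⟩ + R(x)` of FTRL, where `s` is the sum of the losses so far. -/
def ftrlObjective {n : ℕ} (η : ℝ) (R : E n → ℝ) (s x : E n) : ℝ :=
  η * inner ℝ s x + R x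

/-- The point chosen by FTRL. As `R = +∞` on the boundary of `K`, the minimum is over the
interior. -/
def ftrl {n : ℕ} (η : ℝ) (K : Set (E n)) (R : E n → ℝ) (s : E n) : E n :=
  argminOn (interior K) (ftrlObjective η R s)

/-- The learner's coins in one round: an index `i ∈ {1, …, n}` and a sign `ε = ±1`. -/
abbrev Coin (n : ℕ) : Type := Fin n × ℤˣ

/-- The sign `ε` as a real number. -/
def sign {n : ℕ} (c : Coin n) : ℝ := ((c.2 : ℤ) : ℝ)

variable {n : ℕ} {K : Set (E n)} {R : E n → ℝ}

/-- The sampled point `y = x + ε λᵢ^{-1/2} eᵢ`. -/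
def sample (D : HessianEigen K R) (x : E n) (c : Coin n) : E n :=
  x + (sign c * (Real.sqrt (D.val x c.1))⁻¹) • D.vec x c.1

/-- The one-point estimate `n (fᵀy) ε λᵢ^{1/2} eᵢ` of the loss vector `f`; it uses only the
observed cost `fᵀy`. -/
def guess (D : HessianEigen K R) (f x : E n) (c : Coin n) : E n :=
  (n * inner ℝ f (sample D x c) * sign c * Real.sqrt (D.val x c.1)) • D.vec x c.1

/-- The sum of the loss estimates of the first `t` rounds, when the loss vectors are `f` and the
coins are `ω`. Rounds are numbered `0, …, T - 1`. -/
def estimateSum (η : ℝ) (D : HessianEigen K R) {T : ℕ} (f : Fin T → E n) (ω : Fin T → Coin n) :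
    ℕ → E n
  | 0 => 0
  | t + 1 =>
    if h : t < T then
      estimateSum η D f ω t
        + guess D (f ⟨t, h⟩) (ftrl η K R (estimateSum η D f ω t)) (ω ⟨t, h⟩)
    else estimateSum η D f ω t

/-- The point `xₜ` of SCRiBLe in round `t`. -/
def iterate (η : ℝ) (D : HessianEigen K R) {T : ℕ} (f : Fin T → E n) (ω : Fin T → Coin n)
    (t : Fin T) : E n :=
  ftrl η K R (estimateSum η D f ω t)

/-- The prediction `yₜ` of SCRiBLe in round `t`. -/
def prediction (η : ℝ) (D : HessianEigen K R) {T : ℕ} (f : Fin T → E n) (ω : Fin T → Coin n)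
    (t : Fin T) : E n :=
  sample D (iterate η D f ω t) (ω t)

/-- The regret of SCRiBLe against the comparator `u`, for given coins `ω`. -/
def regret (η : ℝ) (D : HessianEigen K R) {T : ℕ} (f : Fin T → E n) (u : E n)
    (ω : Fin T → Coin n) : ℝ :=
  ∑ t, inner ℝ (f t) (prediction η D f ω t) - ∑ t, inner ℝ (f t) u

/-- The expected regret of SCRiBLe: the coins of the `T` rounds are independent, and each is uniform
on `{1, …, n} × {±1}`, that is, `ω` is uniform on the finite set `Fin T → Coin n`. -/
def expectedRegret (η : ℝ) (D : HessianEigen K R) {T : ℕ} (f : Fin T → E n) (u : E n) : ℝ :=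
  Finset.expect Finset.univ fun ω : Fin T → Coin n => regret η D f u ω

end Scrible

end

/-! SCRiBLe is follow-the-regularized-leader (FTRL) run on random linear losses, and three facts
combine.

Geometry. Along a line, self-concordance makes the function `q^{-1/2}`, with `q(t) = D²R(x +
th)[h,h]`, 1-Lipschitz. So `q` stays bounded as long as the path remains in the open Dikin
ellipsoid, whereas a barrier cannot blow up while `q` is bounded; hence the ellipsoid stays inside
the domain (`add_mem`) and the samples are feasible. The same bound, integrated, gives strong
monotonicity of the gradient (`le_fderiv_sub_fderiv`), hence uniqueness and stability of the
minimizers.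

Probability. The point `x_t` depends only on earlier coins, so the coin of round `t` may be averaged
first. This makes the loss estimate unbiased, and the expected regret becomes that of FTRL on the
estimates (`expectedRegret_eq`).

Regret. The estimate has dual local norm at most `C = nL`, however small the ellipsoid is, so each
round costs at most `2ηC²` (`inner_sub_le_of_isMinOn`). The comparator is pulled towards `x₁` by a
fraction `1/T`: this costs `2L` in loss and keeps its barrier value within `ϑ log T` of the minimum
(`sub_le_neg_mul_log`). The choice of `η` balances the two FTRL terms. -/

noncomputable section

namespace Scrible

open Set Filter

/-! ### Derivatives along lines and exit from the domain -/

/-- The quadratic form `D²R(x)[h,h]` of the Hessian. -/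
def quad {n : ℕ} (R : E n → ℝ) (x h : E n) : ℝ := iteratedFDeriv ℝ 2 R x ![h, h]

lemma quad_eq_fderiv {n : ℕ} (R : E n → ℝ) (x h : E n) :
    quad R x h = fderiv ℝ (fderiv ℝ R) x h h := by
  simp [quad, iteratedFDeriv_two_apply]

lemma quad_smul {n : ℕ} (R : E n → ℝ) (x h : E n) (c : ℝ) :
    quad R x (c • h) = c ^ 2 * quad R x h := by
  simp [quad_eq_fderiv]; ring

lemma hasDerivAt_iteratedFDeriv_line {n k : ℕ} {R : E n → ℝ} {x h : E n} {t : ℝ}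
    (hR : ContDiffAt ℝ ((k + 1 : ℕ) : ℕ∞) R (x + t • h)) (m : Fin k → E n) :
    HasDerivAt (fun s : ℝ => iteratedFDeriv ℝ k R (x + s • h) m)
      (iteratedFDeriv ℝ (k + 1) R (x + t • h) (Fin.cons h m)) t := by
  have h1 : DifferentiableAt ℝ (iteratedFDeriv ℝ k R) (x + t • h) := by
    apply hR.differentiableAt_iteratedFDeriv
    norm_cast
    exact lt_add_one k
  have h2 : HasDerivAt (fun s : ℝ => x + s • h) h t := by
    simpa using ((hasDerivAt_id t).smul_const h).const_add x
  have h3 := h1.hasFDerivAt.comp_hasDerivAt t h2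
  have h4 := (ContinuousMultilinearMap.apply ℝ (fun _ : Fin k => E n) ℝ m).hasFDerivAt.comp_hasDerivAt
    t h3
  rw [iteratedFDeriv_succ_apply_left]
  exact h4

namespace IsSelfConcordant

variable {n : ℕ} {K : Set (E n)} {R : E n → ℝ} {x h : E n} {t : ℝ}

lemma contDiffAt (hR : IsSelfConcordant K R) (hx : x ∈ interior K) : ContDiffAt ℝ 3 R x :=
  hR.contDiffOn.contDiffAt (isOpen_interior.mem_nhds hx)

lemma hasDerivAt_line (hR : IsSelfConcordant K R) (hx : x + t • h ∈ interior K) :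
    HasDerivAt (fun s : ℝ => R (x + s • h)) (fderiv ℝ R (x + t • h) h) t := by
  have := hasDerivAt_iteratedFDeriv_line (k := 0) (h := h)
    ((hR.contDiffAt hx).of_le (by norm_cast)) ![]
  simpa using this

lemma hasDerivAt_fderiv_line (hR : IsSelfConcordant K R) (hx : x + t • h ∈ interior K) :
    HasDerivAt (fun s : ℝ => fderiv ℝ R (x + s • h) h) (quad R (x + t • h) h) t := by
  have := hasDerivAt_iteratedFDeriv_line (k := 1) (h := h)
    ((hR.contDiffAt hx).of_le (by norm_cast)) ![h]
  simpa [quad] using this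

lemma hasDerivAt_quad_line (hR : IsSelfConcordant K R) (hx : x + t • h ∈ interior K) :
    HasDerivAt (fun s : ℝ => quad R (x + s • h) h)
      (iteratedFDeriv ℝ 3 R (x + t • h) ![h, h, h]) t :=
  hasDerivAt_iteratedFDeriv_line (k := 2) (h := h)
    ((hR.contDiffAt hx).of_le (by norm_cast)) ![h, h]

lemma exists_exit (hR : IsSelfConcordant K R) (hx : x ∈ interior K) (hxh : x + h ∉ interior K) :
    ∃ a : ℝ, 0 < a ∧ a ≤ 1 ∧ (∀ t ∈ Ico 0 a, x + t • h ∈ interior K) ∧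
      Tendsto (fun t : ℝ => R (x + t • h)) (𝓝[<] a) atTop := by
  have hcont : Continuous fun t : ℝ => x + t • h := by fun_prop
  -- The least element of this compact set of bad times is the first exit time.
  set S : Set ℝ := Icc 0 1 ∩ (fun t : ℝ => x + t • h) ⁻¹' (interior K)ᶜ with hS
  have hSc : IsCompact S :=
    isCompact_Icc.inter_right (isOpen_interior.isClosed_compl.preimage hcont)
  obtain ⟨a, haS, hmin⟩ := hSc.exists_isLeast ⟨1, by simp, by simpa using hxh⟩
  have ha0 : 0 < a := by
    rcases haS.1.1.eq_or_lt with h0 | h0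
    · exact absurd hx (by simpa [← h0] using haS.2)
    · exact h0
  have hin : ∀ t ∈ Ico 0 a, x + t • h ∈ interior K := fun t ht => by
    by_contra hcon
    exact absurd (hmin ⟨⟨ht.1, ht.2.le.trans haS.1.2⟩, hcon⟩) (not_le.2 ht.2)
  have hev : ∀ᶠ t in 𝓝[<] a, x + t • h ∈ interior K := by
    filter_upwards [Ioo_mem_nhdsLT ha0] with t ht using hin t ⟨ht.1.le, ht.2⟩
  have htend : Tendsto (fun t : ℝ => x + t • h) (𝓝[<] a) (𝓝[interior K] (x + a • h)) :=
    tendsto_nhdsWithin_iff.2 ⟨(hcont.tendsto a).mono_left nhdsWithin_le_nhds, hev⟩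
  refine ⟨a, ha0, haS.1.2, hin, (hR.tendsto_frontier _ ⟨?_, haS.2⟩).comp htend⟩
  exact closure_mono interior_subset (mem_closure_of_tendsto (htend.mono_right nhdsWithin_le_nhds) hev)

end IsSelfConcordant

lemma _root_.Bornology.IsBounded.exists_smul_notMem {n : ℕ} {S : Set (E n)}
    (hS : Bornology.IsBounded S) (x : E n) {h : E n} (hh : h ≠ 0) :
    ∃ c : ℝ, 0 < c ∧ x + c • h ∉ S := by
  obtain ⟨M, hM⟩ := hS.exists_norm_le
  have hpos := norm_pos_iff.2 hh
  refine ⟨(|M| + ‖x‖ + 1) / ‖h‖, by positivity, fun hmem => ?_⟩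
  have h1 := hM _ hmem
  have h2 : ‖((|M| + ‖x‖ + 1) / ‖h‖) • h‖ = |M| + ‖x‖ + 1 := by
    rw [norm_smul, Real.norm_of_nonneg (by positivity)]; field_simp
  have h3 := norm_sub_le (x + ((|M| + ‖x‖ + 1) / ‖h‖) • h) x
  rw [add_sub_cancel_left, h2] at h3
  linarith [le_abs_self M]

/-! ### Local geometry of self-concordant barriers -/

namespace IsSelfConcordantBarrier

variable {n : ℕ} {ϑ : ℝ} {K : Set (E n)} {R : E n → ℝ} {x h : E n} {t : ℝ}

/-- A barrier cannot have bounded Hessian form along a segment that leaves the domain. -/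
lemma not_quad_le (hR : IsSelfConcordantBarrier ϑ K R) {a M : ℝ} (ha : 0 < a)
    (hin : ∀ t ∈ Ico 0 a, x + t • h ∈ interior K)
    (htend : Tendsto (fun t : ℝ => R (x + t • h)) (𝓝[<] a) atTop) :
    ¬ ∀ t ∈ Ico 0 a, quad R (x + t • h) h ≤ M := by
  intro hM
  -- The barrier inequality bounds the slope by `√(ϑM)`, so `R` grows at most linearly and cannot
  -- diverge at `a`.
  have hbd : ∀ t ∈ Ico 0 a, R (x + t • h) ≤ R x + Real.sqrt (ϑ * M) * a := fun t ht => by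
    have := (convex_Ico (0 : ℝ) a).norm_image_sub_le_of_norm_hasDerivWithin_le
      (f := fun s : ℝ => R (x + s • h)) (C := Real.sqrt (ϑ * M))
      (fun s hs => (hR.hasDerivAt_line (hin s hs)).hasDerivWithinAt)
      (fun s hs => (hR.first_le _ (hin s hs) h).trans (Real.sqrt_le_sqrt
        (mul_le_mul_of_nonneg_left (hM s hs) hR.nonneg))) (left_mem_Ico.2 ha) ht
    simp only [zero_smul, add_zero, sub_zero, Real.norm_eq_abs, abs_of_nonneg ht.1] at this
    have h2 := (le_abs_self _).trans this
    nlinarith [Real.sqrt_nonneg (ϑ * M), ht.2]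
  obtain ⟨t, ht1, ht2⟩ := ((htend.eventually_gt_atTop (R x + Real.sqrt (ϑ * M) * a)).and
    (Ioo_mem_nhdsLT ha)).exists
  exact absurd (hbd t ⟨ht2.1.le, ht2.2⟩) (not_le.2 ht1)

lemma abs_fderiv_le (hR : IsSelfConcordantBarrier ϑ K R) (hx : x ∈ interior K) (h : E n) :
    |fderiv ℝ R x h| ≤ Real.sqrt (ϑ * quad R x h) :=
  hR.first_le x hx h

/-- Follows from the barrier inequality without convexity: where the form is negative, `Real.sqrt`
returns 0, so the directional derivative vanishes on a neighbourhood in the line and its own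
derivative, the form, is 0. -/
lemma quad_nonneg (hR : IsSelfConcordantBarrier ϑ K R) (hx : x ∈ interior K) (h : E n) :
    0 ≤ quad R x h := by
  by_contra! hneg
  have hx0 : x + (0 : ℝ) • h ∈ interior K := by simpa using hx
  have hcont : Continuous fun t : ℝ => x + t • h := by fun_prop
  have h1 : ∀ᶠ s in 𝓝 (0 : ℝ), x + s • h ∈ interior K :=
    hcont.continuousAt.eventually (isOpen_interior.mem_nhds hx0)
  have h2 : ∀ᶠ s in 𝓝 (0 : ℝ), quad R (x + s • h) h < 0 :=
    (hR.hasDerivAt_quad_line hx0).continuousAt.eventually_lt_const (by simpa using hneg)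
  have h3 : (fun _ : ℝ => (0 : ℝ)) =ᶠ[𝓝 0] fun s : ℝ => fderiv ℝ R (x + s • h) h := by
    filter_upwards [h1, h2] with s hs1 hs2
    have := hR.abs_fderiv_le hs1 h
    rw [Real.sqrt_eq_zero_of_nonpos (mul_nonpos_of_nonneg_of_nonpos hR.nonneg hs2.le)] at this
    exact (abs_nonpos_iff.1 this).symm
  have h4 := ((hR.hasDerivAt_fderiv_line hx0).congr_of_eventuallyEq h3).unique
    (hasDerivAt_const (0 : ℝ) (0 : ℝ))
  rw [zero_smul, add_zero] at h4
  exact hneg.ne h4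

lemma third_le_sqrt (hR : IsSelfConcordantBarrier ϑ K R) (hx : x ∈ interior K) (h : E n) :
    |iteratedFDeriv ℝ 3 R x ![h, h, h]| ≤ 2 * Real.sqrt (quad R x h) ^ 3 := by
  have := hR.third_le x hx h
  rwa [Real.sqrt_eq_rpow, ← Real.rpow_natCast, ← Real.rpow_mul (hR.quad_nonneg hx h),
    show (1 / 2 * ((3 : ℕ) : ℝ) : ℝ) = 3 / 2 by norm_num]

/-- Since `|q'| ≤ 2 q^{3/2}`, a zero of `q` propagates along the line by Grönwall's inequality. In a
bounded domain the line must exit, which `not_quad_le` forbids when `q = 0` throughout. -/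
lemma quad_pos (hR : IsSelfConcordantBarrier ϑ K R) (hK : Bornology.IsBounded K)
    (hx : x ∈ interior K) (hh : h ≠ 0) : 0 < quad R x h := by
  refine (hR.quad_nonneg hx h).lt_of_ne' fun h0 => ?_
  obtain ⟨c, -, hcK⟩ := hK.exists_smul_notMem x hh
  set k := c • h
  have hk0 : quad R x k = 0 := by rw [quad_smul, h0, mul_zero]
  obtain ⟨a, ha, -, hin, htend⟩ := hR.exists_exit hx (fun hm => hcK (interior_subset hm))
  refine hR.not_quad_le ha hin htend (M := 0) fun b hb => le_of_eq ?_
  have hinb : ∀ s ∈ Icc 0 b, x + s • k ∈ interior K := fun s hs => hin s ⟨hs.1, hs.2.trans_lt hb.2⟩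
  have hcont : ContinuousOn (fun s : ℝ => quad R (x + s • k) k) (Icc 0 b) := fun s hs =>
    (hR.hasDerivAt_quad_line (hinb s hs)).continuousAt.continuousWithinAt
  obtain ⟨C, hC⟩ := isCompact_Icc.exists_bound_of_continuousOn hcont
  refine eq_zero_of_abs_deriv_le_mul_abs_self_of_eq_zero_right (K := 2 * Real.sqrt C) hcont
    (fun s hs => (hR.hasDerivAt_quad_line (hinb s (Ico_subset_Icc_self hs))).hasDerivWithinAt)
    (by simpa using hk0) (fun s hs => ?_) b (right_mem_Icc.2 hb.1)
  have hs' := hinb s (Ico_subset_Icc_self hs)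
  have hq := hR.quad_nonneg hs' k
  have h1 := hC s (Ico_subset_Icc_self hs)
  rw [Real.norm_of_nonneg hq] at h1 ⊢
  calc ‖iteratedFDeriv ℝ 3 R (x + s • k) ![k, k, k]‖ ≤ 2 * Real.sqrt (quad R (x + s • k) k) ^ 3 :=
        hR.third_le_sqrt hs' k
    _ = 2 * Real.sqrt (quad R (x + s • k) k) * quad R (x + s • k) k := by
        rw [pow_succ', Real.sq_sqrt hq]; ring
    _ ≤ 2 * Real.sqrt C * quad R (x + s • k) k := by gcongr

/-- `t ↦ D²R(x + th)[h,h]^{-1/2}` is 1-Lipschitz. -/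
lemma abs_inv_sqrt_quad_sub_le (hR : IsSelfConcordantBarrier ϑ K R) (hK : Bornology.IsBounded K)
    (hh : h ≠ 0) (ht : 0 ≤ t) (hin : ∀ s ∈ Icc 0 t, x + s • h ∈ interior K) :
    |(Real.sqrt (quad R (x + t • h) h))⁻¹ - (Real.sqrt (quad R x h))⁻¹| ≤ t := by
  -- The derivative is `-q' / (2 q^{3/2})`, of absolute value at most 1 by self-concordance.
  have := (convex_Icc (0 : ℝ) t).norm_image_sub_le_of_norm_hasDerivWithin_le
      (f := fun s : ℝ => (Real.sqrt (quad R (x + s • h) h))⁻¹) (C := 1)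
      (fun s hs => (((hR.hasDerivAt_quad_line (hin s hs)).sqrt
        (hR.quad_pos hK (hin s hs) hh).ne').fun_inv
          (Real.sqrt_pos.2 (hR.quad_pos hK (hin s hs) hh)).ne').hasDerivWithinAt)
      (fun s hs => ?_) (left_mem_Icc.2 ht) (right_mem_Icc.2 ht)
  · simpa [abs_of_nonneg ht] using this
  · have h1 := hR.third_le_sqrt (hin s hs) h
    have h2 := Real.sqrt_pos.2 (hR.quad_pos hK (hin s hs) hh)
    rw [Real.norm_eq_abs, abs_div, abs_neg, abs_div, abs_of_pos (mul_pos two_pos h2),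
      abs_of_pos (pow_pos h2 2), div_div, div_le_one (by positivity)]
    linarith

/-- The open Dikin ellipsoid lies in the interior of the domain. -/
lemma add_mem_interior (hR : IsSelfConcordantBarrier ϑ K R) (hK : Bornology.IsBounded K)
    (hx : x ∈ interior K) (hq : quad R x h < 1) : x + h ∈ interior K := by
  by_contra hcon
  have hh : h ≠ 0 := by rintro rfl; simp [hx] at hcon
  obtain ⟨a, ha, ha1, hin, htend⟩ := hR.exists_exit hx hcon
  have hr : 0 < Real.sqrt (quad R x h) := Real.sqrt_pos.2 (hR.quad_pos hK hx hh)
  have hr1 : Real.sqrt (quad R x h) < 1 := (Real.sqrt_lt' one_pos).2 (by simpa using hq)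
  set d := (Real.sqrt (quad R x h))⁻¹ - 1
  have hd : 0 < d := sub_pos.2 ((one_lt_inv₀ hr).2 hr1)
  -- Before the exit time `a ≤ 1`, the Lipschitz bound gives `q(t)^{-1/2} ≥ q(0)^{-1/2} - t ≥ d`.
  refine hR.not_quad_le ha hin htend (M := (d⁻¹) ^ 2) fun t ht => ?_
  have h1 := (abs_le.1 (hR.abs_inv_sqrt_quad_sub_le hK hh ht.1
    fun s hs => hin s ⟨hs.1, hs.2.trans_lt ht.2⟩)).1
  rw [← Real.sqrt_le_left (by positivity)]
  refine le_inv_of_le_inv₀ hd ?_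
  have := ht.2
  simp only [d]
  linarith

/-- The closed Dikin ellipsoid lies in the domain. -/
lemma add_mem (hR : IsSelfConcordantBarrier ϑ K R) (hK : IsCompact K)
    (hx : x ∈ interior K) (hq : quad R x h ≤ 1) : x + h ∈ K := by
  have hcont : Continuous fun t : ℝ => x + t • h := by fun_prop
  have h1 : Tendsto (fun t : ℝ => x + t • h) (𝓝[<] 1) (𝓝 (x + h)) := by
    simpa using (hcont.tendsto 1).mono_left nhdsWithin_le_nhds
  refine hK.isClosed.mem_of_tendsto h1 ?_
  filter_upwards [Ioo_mem_nhdsLT (zero_lt_one (α := ℝ))] with t ht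
  refine interior_subset (hR.add_mem_interior hK.isBounded hx ?_)
  rw [quad_smul]
  have : t ^ 2 < 1 := by nlinarith [ht.1, ht.2]
  nlinarith [hR.quad_nonneg hx h, ht.1]

/-- Strong monotonicity of the gradient in the local norm. -/
lemma le_fderiv_sub_fderiv (hR : IsSelfConcordantBarrier ϑ K R) (hK : Bornology.IsBounded K)
    (hh : h ≠ 0) (hin : ∀ s ∈ Icc (0 : ℝ) 1, x + s • h ∈ interior K) :
    quad R x h / (1 + Real.sqrt (quad R x h)) ≤ fderiv ℝ R (x + h) h - fderiv ℝ R x h := by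
  have hx : x ∈ interior K := by simpa using hin 0 (by simp)
  have hq := hR.quad_pos hK hx hh
  set r := Real.sqrt (quad R x h) with hr_def
  have hr : 0 < r := Real.sqrt_pos.2 hq
  have hrq : r ^ 2 = quad R x h := Real.sq_sqrt hq.le
  -- The Lipschitz bound yields `q(s) ≥ r² / (1 + rs)²`; the added term `r / (1 + rs)` is an
  -- antiderivative of minus this lower bound.
  have hder : ∀ s ∈ Icc (0 : ℝ) 1, HasDerivAt
      (fun s : ℝ => fderiv ℝ R (x + s • h) h + r * (1 + r * s)⁻¹)
      (quad R (x + s • h) h + r * (-(r * 1) / (1 + r * s) ^ 2)) s := fun s hs => by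
    have h0 : (1 + r * s) ≠ 0 := by have := hs.1; positivity
    exact (hR.hasDerivAt_fderiv_line (hin s hs)).add
      (((((hasDerivAt_id s).const_mul r).const_add 1).fun_inv h0).const_mul r)
  have hmono : MonotoneOn (fun s : ℝ => fderiv ℝ R (x + s • h) h + r * (1 + r * s)⁻¹)
      (Icc 0 1) := by
    refine monotoneOn_of_hasDerivWithinAt_nonneg (convex_Icc 0 1)
      (fun s hs => (hder s hs).continuousAt.continuousWithinAt)
      (fun s hs => (hder s (interior_subset hs)).hasDerivWithinAt) fun s hs => ?_
    have hs := interior_subset hs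
    have h1 := (abs_le.1 (hR.abs_inv_sqrt_quad_sub_le hK hh hs.1
      fun u hu => hin u ⟨hu.1, hu.2.trans hs.2⟩)).2
    have hqs := hR.quad_pos hK (hin s hs) hh
    have hw := Real.sqrt_pos.2 hqs
    have hs0 := hs.1
    have h2 : (Real.sqrt (quad R (x + s • h) h))⁻¹ ≤ (1 + r * s) / r := by
      rw [← hr_def] at h1
      calc _ ≤ r⁻¹ + s := by linarith
        _ = _ := by field_simp
    have h3 : r / (1 + r * s) ≤ Real.sqrt (quad R (x + s • h) h) := by
      rw [inv_le_comm₀ hw (by positivity), inv_div] at h2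
      exact h2
    have h4 : (r / (1 + r * s)) ^ 2 ≤ quad R (x + s • h) h := by
      rw [← Real.sq_sqrt hqs.le]; gcongr
    have h5 : r * (-(r * 1) / (1 + r * s) ^ 2) = - (r / (1 + r * s)) ^ 2 := by
      rw [div_pow]; ring
    rw [h5]; linarith
  have := hmono (left_mem_Icc.2 zero_le_one) (right_mem_Icc.2 zero_le_one) zero_le_one
  simp only [zero_smul, add_zero, mul_zero, inv_one, mul_one, one_smul] at this
  have h6 : quad R x h / (1 + r) = r - r * (1 + r)⁻¹ := by rw [← hrq]; field_simp; ring
  rw [h6]; linarith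

/-- Growth of a barrier along a segment, in terms of the Minkowski function. -/
lemma sub_le_neg_mul_log (hR : IsSelfConcordantBarrier ϑ K R) (hϑ : 0 < ϑ)
    (hin : ∀ s ∈ Ico (0 : ℝ) 1, x + s • h ∈ interior K) (ht : t ∈ Ico (0 : ℝ) 1) :
    R (x + t • h) - R x ≤ -ϑ * Real.log (1 - t) := by
  have hmono : MonotoneOn (fun s : ℝ => fderiv ℝ R (x + s • h) h) (Ico 0 1) :=
    monotoneOn_of_hasDerivWithinAt_nonneg (convex_Ico 0 1)
      (fun s hs => (hR.hasDerivAt_fderiv_line (hin s hs)).continuousAt.continuousWithinAt)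
      (fun s hs => (hR.hasDerivAt_fderiv_line (hin s (interior_subset hs))).hasDerivWithinAt)
      (fun s hs => hR.quad_nonneg (hin s (interior_subset hs)) h)
  -- With `φ` the slope, the barrier inequality reads `φ² ≤ ϑφ'`, so `-ϑ/φ(u) - u` is nondecreasing
  -- where `φ > 0`. As `-ϑ/φ` stays negative, letting `u → 1` gives `1 ≤ s + ϑ/φ(s)`.
  have hslope : ∀ s ∈ Ico (0 : ℝ) 1, fderiv ℝ R (x + s • h) h ≤ ϑ / (1 - s) := fun s hs => by
    have hs1 : 0 < 1 - s := sub_pos.2 hs.2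
    rcases le_or_gt (fderiv ℝ R (x + s • h) h) 0 with hp | hp
    · exact hp.trans (by positivity)
    set p := fderiv ℝ R (x + s • h) h
    have hposs : ∀ u ∈ Ico s 1, 0 < fderiv ℝ R (x + u • h) h := fun u hu =>
      hp.trans_le (hmono hs ⟨hs.1.trans hu.1, hu.2⟩ hu.1)
    have hinu : ∀ u ∈ Ico s 1, x + u • h ∈ interior K := fun u hu => hin u ⟨hs.1.trans hu.1, hu.2⟩
    have hder : ∀ u ∈ Ico s 1, HasDerivAt
        (fun u : ℝ => -(ϑ * (fderiv ℝ R (x + u • h) h)⁻¹) - u)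
        (-(ϑ * (-quad R (x + u • h) h / (fderiv ℝ R (x + u • h) h) ^ 2)) - 1) u := fun u hu =>
      (((hR.hasDerivAt_fderiv_line (hinu u hu)).fun_inv (hposs u hu).ne').const_mul ϑ).neg.sub
        (hasDerivAt_id u)
    have hm : MonotoneOn (fun u : ℝ => -(ϑ * (fderiv ℝ R (x + u • h) h)⁻¹) - u) (Ico s 1) := by
      refine monotoneOn_of_hasDerivWithinAt_nonneg (convex_Ico s 1)
        (fun u hu => (hder u hu).continuousAt.continuousWithinAt)
        (fun u hu => (hder u (interior_subset hu)).hasDerivWithinAt) fun u hu => ?_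
      have hu := interior_subset hu
      have h1 := hR.abs_fderiv_le (hinu u hu) h
      have hpu := hposs u hu
      rw [abs_of_pos hpu, Real.le_sqrt' hpu] at h1
      have h2 : -(ϑ * (-quad R (x + u • h) h / (fderiv ℝ R (x + u • h) h) ^ 2)) =
        ϑ * quad R (x + u • h) h / (fderiv ℝ R (x + u • h) h) ^ 2 := by ring
      rw [h2, sub_nonneg, one_le_div (by positivity)]
      exact h1
    have hle : ∀ u ∈ Ico s 1, u ≤ s + ϑ * p⁻¹ := fun u hu => by
      have h1 := hm (left_mem_Ico.2 hs.2) hu hu.1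
      have h2 : 0 < ϑ * (fderiv ℝ R (x + u • h) h)⁻¹ := mul_pos hϑ (inv_pos.2 (hposs u hu))
      simp only at h1
      linarith
    have h1 : 1 ≤ s + ϑ * p⁻¹ := by
      by_contra! hlt
      obtain ⟨u, hu1, hu2⟩ := exists_between (max_lt hlt hs.2)
      exact absurd (hle u ⟨((le_max_right _ _).trans_lt hu1).le, hu2⟩)
        (not_le.2 ((le_max_left _ _).trans_lt hu1))
    rw [le_div_iff₀ hs1]
    have h2 : p * (1 - s) ≤ p * (ϑ * p⁻¹) := by gcongr; linarith
    rwa [mul_left_comm, mul_inv_cancel₀ hp.ne', mul_one] at h2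
  have hder : ∀ s ∈ Ico (0 : ℝ) 1, HasDerivAt
      (fun s : ℝ => -ϑ * Real.log (1 - s) - R (x + s • h))
      (-ϑ * (-1 / (1 - s)) - fderiv ℝ R (x + s • h) h) s := fun s hs =>
    ((((hasDerivAt_id s).const_sub 1).log (sub_pos.2 hs.2).ne').const_mul (-ϑ)).sub
      (hR.hasDerivAt_line (hin s hs))
  have hm := monotoneOn_of_hasDerivWithinAt_nonneg (convex_Ico 0 1)
    (fun s hs => (hder s hs).continuousAt.continuousWithinAt)
    (fun s hs => (hder s (interior_subset hs)).hasDerivWithinAt) (fun s hs => by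
      have := hslope s (interior_subset hs)
      have h2 : -ϑ * (-1 / (1 - s)) = ϑ / (1 - s) := by ring
      rw [h2]; linarith) (left_mem_Ico.2 zero_lt_one) ht ht.1
  simp only [sub_zero, Real.log_one, mul_zero, zero_smul, add_zero] at hm
  linarith

/-- For `ϑ = 0` the gradient, hence the Hessian form, would vanish, against `quad_pos`. Positivity
makes `η > 0`, so the regret bound can be divided by `η`. -/
lemma parameter_pos (hR : IsSelfConcordantBarrier ϑ K R) (hn : 1 ≤ n)
    (hK : Bornology.IsBounded K) (hKint : (interior K).Nonempty) : 0 < ϑ := by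
  obtain ⟨x, hx⟩ := hKint
  have : Nontrivial (E n) := by
    have : NeZero n := ⟨by omega⟩
    infer_instance
  obtain ⟨h, hh⟩ := exists_ne (0 : E n)
  refine hR.nonneg.lt_of_ne fun h0 => ?_
  have h1 : ∀ y ∈ interior K, fderiv ℝ R y h = 0 := fun y hy => by
    have := hR.first_le y hy h
    rw [← h0, zero_mul, Real.sqrt_zero] at this
    exact abs_nonpos_iff.1 this
  have hcont : Continuous fun t : ℝ => x + t • h := by fun_prop
  have hx0 : x + (0 : ℝ) • h ∈ interior K := by simpa using hx
  have h2 : ∀ᶠ s in 𝓝 (0 : ℝ), x + s • h ∈ interior K :=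
    hcont.continuousAt.eventually (isOpen_interior.mem_nhds hx0)
  have h3 : (fun _ : ℝ => (0 : ℝ)) =ᶠ[𝓝 0] fun s : ℝ => fderiv ℝ R (x + s • h) h :=
    h2.mono fun s hs => (h1 _ hs).symm
  have h4 := ((hR.hasDerivAt_fderiv_line hx0).congr_of_eventuallyEq h3).unique
    (hasDerivAt_const (0 : ℝ) (0 : ℝ))
  rw [zero_smul, add_zero] at h4
  exact (hR.quad_pos hK hx hh).ne' h4

end IsSelfConcordantBarrier

/-! ### The Hessian in its eigenbasis -/

lemma inner_hessian {n : ℕ} {R : E n → ℝ} {x : E n} (hR : ContDiffAt ℝ 3 R x) (h k : E n) :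
    inner ℝ (hessian R x h) k = fderiv ℝ (fderiv ℝ R) x h k := by
  have hd : DifferentiableAt ℝ (fderiv ℝ R) x :=
    (hR.fderiv_right (m := 2) (by norm_cast)).differentiableAt (by norm_num)
  have hinner : ∀ y k, inner ℝ (gradient R y) k = fderiv ℝ R y k := fun y k => by
    simp [gradient]
  have hg : DifferentiableAt ℝ (gradient R) x := by
    rw [differentiableAt_euclidean]
    intro i
    have : (fun y => (gradient R y) i) = fun y => fderiv ℝ R y (EuclideanSpace.single i 1) := by
      funext y
      rw [← hinner, real_inner_comm, EuclideanSpace.inner_single_left]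
      simp
    rw [this]
    fun_prop
  have h1 := hg.hasFDerivAt.inner ℝ (hasFDerivAt_const k x)
  simp only [hinner] at h1
  have h2 := hd.hasFDerivAt.clm_apply (hasFDerivAt_const k x)
  have h3 := DFunLike.congr_fun (h1.unique h2) h
  simpa [hessian] using h3

namespace HessianEigen

variable {n : ℕ} {K : Set (E n)} {R : E n → ℝ}

lemma quad_eq_sum (hR : IsSelfConcordant K R) (D : HessianEigen K R) {x : E n}
    (hx : x ∈ interior K) (h : E n) :
    quad R x h = ∑ i, D.val x i * inner ℝ (D.vec x i) h ^ 2 := by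
  rw [quad_eq_fderiv, ← inner_hessian (hR.contDiffAt hx)]
  conv_lhs => enter [2, 2]; rw [← (D.vec x).sum_repr' h]
  simp only [map_sum, map_smul, D.hessian_vec x hx, sum_inner, real_inner_smul_left]
  exact Finset.sum_congr rfl fun i _ => by ring

lemma quad_vec (hR : IsSelfConcordant K R) (D : HessianEigen K R) {x : E n}
    (hx : x ∈ interior K) (i : Fin n) : quad R x (D.vec x i) = D.val x i := by
  rw [quad_eq_fderiv, ← inner_hessian (hR.contDiffAt hx), D.hessian_vec x hx,
    real_inner_smul_left, real_inner_self_eq_norm_sq, (D.vec x).orthonormal.1 i]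
  ring

end HessianEigen

lemma sign_sq {n : ℕ} (c : Coin n) : sign c ^ 2 = 1 := by
  rcases Int.units_eq_one_or c.2 with h | h <;> simp [sign, h]

lemma abs_sign {n : ℕ} (c : Coin n) : |sign c| = 1 := by
  rcases Int.units_eq_one_or c.2 with h | h <;> simp [sign, h]

/-! ### Feasible samples; existence, uniqueness and stability of the FTRL minimizer -/

namespace IsSelfConcordantBarrier

variable {n : ℕ} {ϑ η : ℝ} {K : Set (E n)} {R : E n → ℝ} {x y z h s : E n}

lemma val_pos (hR : IsSelfConcordantBarrier ϑ K R) (hK : Bornology.IsBounded K)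
    (D : HessianEigen K R) (hx : x ∈ interior K) (i : Fin n) : 0 < D.val x i := by
  rw [← D.quad_vec hR.toIsSelfConcordant hx]
  exact hR.quad_pos hK hx ((D.vec x).orthonormal.ne_zero i)

lemma sample_mem (hR : IsSelfConcordantBarrier ϑ K R) (hK : IsCompact K)
    (D : HessianEigen K R) (hx : x ∈ interior K) (c : Coin n) : sample D x c ∈ K := by
  have hv := hR.val_pos hK.isBounded D hx c.1
  -- The displacement has local norm exactly 1, so the closed ellipsoid is needed.
  refine hR.add_mem hK hx (le_of_eq ?_)
  rw [quad_smul, D.quad_vec hR.toIsSelfConcordant hx, mul_pow, sign_sq, inv_pow,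
    Real.sq_sqrt hv.le]
  field_simp

/-- The dual local norm of the loss estimate is at most `n |fᵀy|`. -/
lemma inner_guess_le (hR : IsSelfConcordantBarrier ϑ K R) (hK : IsCompact K)
    (D : HessianEigen K R) (hx : x ∈ interior K) {f : E n} {L : ℝ}
    (hf : ∀ y ∈ K, |inner ℝ f y| ≤ L) (c : Coin n) (h : E n) :
    inner ℝ (guess D f x c) h ≤ n * L * Real.sqrt (quad R x h) := by
  have hv := hR.val_pos hK.isBounded D hx
  -- The square of the left side is a single term of the nonnegative spectral sum for the form.
  have h1 : Real.sqrt (D.val x c.1) * |inner ℝ (D.vec x c.1) h| ≤ Real.sqrt (quad R x h) := by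
    apply Real.le_sqrt_of_sq_le
    rw [mul_pow, Real.sq_sqrt (hv c.1).le, sq_abs, D.quad_eq_sum hR.toIsSelfConcordant hx]
    exact Finset.single_le_sum (f := fun i => D.val x i * inner ℝ (D.vec x i) h ^ 2)
      (fun i _ => mul_nonneg (hv i).le (sq_nonneg _)) (Finset.mem_univ c.1)
  have h2 := hf _ (hR.sample_mem hK D hx c)
  have hL : 0 ≤ L := (abs_nonneg _).trans h2
  rw [guess, real_inner_smul_left]
  refine (le_abs_self _).trans ?_
  rw [abs_mul, abs_mul, abs_mul, abs_mul, abs_sign, Nat.abs_cast, abs_of_nonneg (Real.sqrt_nonneg _)]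
  calc _ = (n * |inner ℝ f (sample D x c)|) *
        (Real.sqrt (D.val x c.1) * |inner ℝ (D.vec x c.1) h|) := by ring
    _ ≤ _ := by gcongr

/-- Divergence at the frontier makes a sublevel set closed in the whole space, hence compact; the
linear term is harmless since it is bounded near each frontier point. -/
lemma exists_isMinOn_ftrlObjective (hR : IsSelfConcordantBarrier ϑ K R) (hK : IsCompact K)
    (hKint : (interior K).Nonempty) (η : ℝ) (s : E n) :
    ∃ x ∈ interior K, IsMinOn (ftrlObjective η R s) (interior K) x := by
  obtain ⟨x₀, hx₀⟩ := hKint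
  have hcont : ContinuousOn (ftrlObjective η R s) (interior K) :=
    ContinuousOn.add (by fun_prop) hR.contDiffOn.continuousOn
  set S := {x | x ∈ interior K ∧ ftrlObjective η R s x ≤ ftrlObjective η R s x₀} with hS
  have hSK : S ⊆ interior K := fun x hx => hx.1
  have hScl : IsClosed S := by
    refine isClosed_of_closure_subset fun z hz => ?_
    have hfreq := mem_closure_iff_frequently.1 hz
    by_cases hzi : z ∈ interior K
    · refine ⟨hzi, ?_⟩
      by_contra! hlt
      exact hfreq (((hcont.continuousAt (isOpen_interior.mem_nhds hzi)).eventually_const_lt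
        hlt).mono fun w hw hwS => absurd hwS.2 (not_le.2 hw))
    · have hlin : Tendsto (fun w : E n => η * inner ℝ s w) (𝓝[interior K] z)
          (𝓝 (η * inner ℝ s z)) :=
        (Continuous.tendsto (by fun_prop) z).mono_left nhdsWithin_le_nhds
      have hfr : z ∈ frontier K :=
        ⟨closure_mono (hSK.trans interior_subset) hz, hzi⟩
      have htop := tendsto_atTop_add_left_of_le' _ (η * inner ℝ s z - 1)
        ((hlin.eventually_const_lt (by linarith)).mono fun w hw => le_of_lt hw)
        (hR.tendsto_frontier z hfr)
      have hev := eventually_nhdsWithin_iff.1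
        (htop.eventually_gt_atTop (ftrlObjective η R s x₀))
      exact absurd (hev.mono fun w hw hwS => absurd hwS.2 (not_le.2 (hw hwS.1))) hfreq
  have hSc : IsCompact S := hK.of_isClosed_subset hScl (hSK.trans interior_subset)
  obtain ⟨x, hxS, hmin⟩ := hSc.exists_isMinOn ⟨x₀, hx₀, le_rfl⟩ (hcont.mono hSK)
  refine ⟨x, hxS.1, fun w hw => ?_⟩
  rcases le_total (ftrlObjective η R s w) (ftrlObjective η R s x₀) with hle | hle
  · exact hmin ⟨hw, hle⟩
  · exact hxS.2.trans hle

lemma ftrl_spec (hR : IsSelfConcordantBarrier ϑ K R) (hK : IsCompact K)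
    (hKint : (interior K).Nonempty) (η : ℝ) (s : E n) :
    ftrl η K R s ∈ interior K ∧ IsMinOn (ftrlObjective η R s) (interior K) (ftrl η K R s) :=
  Classical.epsilon_spec (hR.exists_isMinOn_ftrlObjective hK hKint η s)

lemma fderiv_of_isMinOn (hR : IsSelfConcordantBarrier ϑ K R) (hx : x ∈ interior K)
    (hmin : IsMinOn (ftrlObjective η R s) (interior K) x) (h : E n) :
    fderiv ℝ R x h = -(η * inner ℝ s h) := by
  have hd : HasFDerivAt (ftrlObjective η R s) (η • innerSL ℝ s + fderiv ℝ R x) x :=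
    ((innerSL ℝ s).hasFDerivAt.const_mul η).add
      ((hR.contDiffAt hx).differentiableAt (by norm_num)).hasFDerivAt
  have h0 := DFunLike.congr_fun
    ((hmin.isLocalMin (isOpen_interior.mem_nhds hx)).hasFDerivAt_eq_zero hd) h
  simp at h0
  linarith

lemma segment_mem (hKconv : Convex ℝ K) (hx : x ∈ interior K) (hy : y ∈ interior K) :
    ∀ t ∈ Icc (0 : ℝ) 1, x + t • (y - x) ∈ interior K := fun _ ht =>
  hKconv.interior.add_smul_sub_mem hx hy ht

/-- Two minimizers would share the gradient `-ηs`, contradicting strong monotonicity. -/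
lemma ftrlObjective_lt (hR : IsSelfConcordantBarrier ϑ K R) (hK : Bornology.IsBounded K)
    (hKconv : Convex ℝ K) (hx : x ∈ interior K)
    (hmin : IsMinOn (ftrlObjective η R s) (interior K) x) (hz : z ∈ interior K) (hne : z ≠ x) :
    ftrlObjective η R s x < ftrlObjective η R s z := by
  by_contra! hle
  have hminz : IsMinOn (ftrlObjective η R s) (interior K) z := fun w hw => hle.trans (hmin hw)
  have hne' := sub_ne_zero.2 hne
  have h1 := hR.le_fderiv_sub_fderiv hK hne' (segment_mem hKconv hx hz)
  rw [add_sub_cancel, hR.fderiv_of_isMinOn hx hmin, hR.fderiv_of_isMinOn hz hminz, sub_self] at h1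
  have hq := hR.quad_pos hK hx hne'
  exact absurd h1 (not_le.2 (by positivity))

/-- Stability of FTRL: the minimizer moves little in the local norm when a loss is added. -/
lemma inner_sub_le_of_isMinOn (hR : IsSelfConcordantBarrier ϑ K R) (hK : Bornology.IsBounded K)
    (hKconv : Convex ℝ K) (hη : 0 ≤ η) {g : E n} {C : ℝ}
    (hx : x ∈ interior K) (hmin : IsMinOn (ftrlObjective η R s) (interior K) x)
    (hy : y ∈ interior K) (hminy : IsMinOn (ftrlObjective η R (s + g)) (interior K) y)
    (hg : ∀ h, inner ℝ g h ≤ C * Real.sqrt (quad R x h)) (hC : 0 ≤ C) (hηC : η * C ≤ 1 / 2) :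
    inner ℝ g (x - y) ≤ 2 * η * C ^ 2 := by
  rcases eq_or_ne y x with rfl | hne
  · simp only [sub_self, inner_zero_right]; positivity
  have hne' := sub_ne_zero.2 hne
  have h1 := hR.le_fderiv_sub_fderiv hK hne' (segment_mem hKconv hx hy)
  have hq := hR.quad_pos hK hx hne'
  have h2 := hg (x - y)
  have hqn : quad R x (x - y) = quad R x (y - x) := by
    rw [← neg_sub y x, ← neg_one_smul ℝ, quad_smul]; norm_num
  rw [add_sub_cancel, hR.fderiv_of_isMinOn hx hmin, hR.fderiv_of_isMinOn hy hminy,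
    inner_add_left] at h1
  rw [hqn] at h2
  have hneg : inner ℝ g (y - x) = -inner ℝ g (x - y) := by rw [← inner_neg_right, neg_sub]
  set r := Real.sqrt (quad R x (y - x))
  have hr : 0 < r := Real.sqrt_pos.2 hq
  rw [← Real.sq_sqrt hq.le, div_le_iff₀ (by positivity), hneg] at h1
  -- Stationarity at both points turns strong monotonicity into `r² / (1 + r) ≤ η⟨g, x - y⟩ ≤ ηCr`.
  -- Then `ηC ≤ 1/2` absorbs the `r` on the right and leaves `r ≤ 2ηC`.
  have h3 : r * r ≤ r * (η * C * (1 + r)) := by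
    have : η * inner ℝ g (x - y) * (1 + r) ≤ η * (C * r) * (1 + r) := by gcongr
    nlinarith
  have h4 : r ≤ η * C * (1 + r) := le_of_mul_le_mul_left h3 hr
  have h5 : r ≤ 2 * (η * C) := by nlinarith
  calc _ ≤ C * r := h2
    _ ≤ C * (2 * (η * C)) := by gcongr
    _ = _ := by ring

end IsSelfConcordantBarrier

/-! ### Averaging over the coins -/

/-- Averaging over one coordinate first does not change the expectation. -/
lemma expect_apply_coord {ι α : Type*} [Fintype ι] [DecidableEq ι] [Fintype α] [Nonempty α]
    (t : ι) (G : (ι → α) → α → ℝ) (hG : ∀ ω c d, G (Function.update ω t c) d = G ω d) :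
    Finset.expect Finset.univ (fun ω : ι → α => G ω (ω t)) =
      Finset.expect Finset.univ fun ω : ι → α => Finset.expect Finset.univ (G ω) := by
  -- Exchanging coordinate `t` with a fresh independent copy is a bijection, so it preserves the
  -- uniform average.
  have hinv : Function.Involutive
      fun p : (ι → α) × α => (Function.update p.1 t p.2, p.1 t) := fun p => by simp
  calc _ = Finset.expect Finset.univ fun ω : ι → α =>
        Finset.expect Finset.univ fun _ : α => G ω (ω t) := by
        simp only [Fintype.expect_const]
    _ = Finset.expect Finset.univ fun p : (ι → α) × α => G p.1 (p.1 t) :=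
        (Finset.expect_product Finset.univ Finset.univ fun p : (ι → α) × α => G p.1 (p.1 t)).symm
    _ = Finset.expect Finset.univ fun p : (ι → α) × α => G p.1 p.2 :=
        Fintype.expect_equiv hinv.toPerm _ _ fun p => by
          simp [Function.Involutive.toPerm, hG]
    _ = _ := Finset.expect_product Finset.univ Finset.univ fun p : (ι → α) × α => G p.1 p.2

/-- The loss estimate is unbiased, and so is the observed cost. -/
lemma expect_inner_sample_sub_inner_guess {n : ℕ} {K : Set (E n)} {R : E n → ℝ} (hn : 1 ≤ n)
    (D : HessianEigen K R) {x : E n} (hpos : ∀ i, 0 < D.val x i) (f u : E n) :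
    Finset.expect Finset.univ (fun c : Coin n =>
      (inner ℝ f (sample D x c) - inner ℝ (guess D f x c) (x - u) : ℝ)) = inner ℝ f u := by
  have : NeZero n := ⟨by omega⟩
  -- Averaging over the sign kills the terms odd in `ε`; in the even term `λᵢ^{1/2}` and `λᵢ^{-1/2}`
  -- cancel. The factor `n` then offsets the uniform choice of `i`.
  have hinner : ∀ i : Fin n, (Finset.expect Finset.univ fun e : ℤˣ =>
      (inner ℝ f (sample D x (i, e)) - inner ℝ (guess D f x (i, e)) (x - u) : ℝ)) =
      inner ℝ f x - n * (inner ℝ f (D.vec x i) * inner ℝ (D.vec x i) (x - u)) := fun i => by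
    have hs : Real.sqrt (D.val x i) ≠ 0 := (Real.sqrt_pos.2 (hpos i)).ne'
    rw [Finset.expect_eq_sum_div_card, Finset.card_univ, Fintype.card_units_int, UnitsInt.univ,
      Finset.sum_pair (by decide)]
    simp only [sample, guess, sign, inner_add_right, real_inner_smul_left, real_inner_smul_right,
      Units.val_one, Units.val_neg, Int.cast_one, Int.cast_neg]
    push_cast
    field_simp
    ring
  rw [← Finset.univ_product_univ, Finset.expect_product]
  simp only [hinner]
  rw [Finset.expect_sub_distrib, Fintype.expect_const, ← Finset.mul_expect,
    Finset.expect_eq_sum_div_card, (D.vec x).sum_inner_mul_inner, Finset.card_univ,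
    Fintype.card_fin, mul_div_cancel₀ _ (by exact_mod_cast NeZero.ne n), inner_sub_right]
  ring

/-- The coin of round `t` affects only later points; this is the independence that lets it be
averaged with `x_t` held fixed. -/
lemma estimateSum_update {n T : ℕ} {K : Set (E n)} {R : E n → ℝ} (η : ℝ) (D : HessianEigen K R)
    (f : Fin T → E n) (ω : Fin T → Coin n) (t : Fin T) (c : Coin n) :
    ∀ k : ℕ, k ≤ t →
      estimateSum η D f (Function.update ω t c) k = estimateSum η D f ω k
  | 0, _ => rfl
  | k + 1, hk => by
    have hkT : k < T := by omega
    have hne : (⟨k, hkT⟩ : Fin T) ≠ t := fun h => by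
      have := congrArg Fin.val h
      simp only at this
      omega
    simp only [estimateSum, dif_pos hkT, estimateSum_update η D f ω t c k (by omega),
      Function.update_of_ne hne]

lemma iterate_update {n T : ℕ} {K : Set (E n)} {R : E n → ℝ} (η : ℝ) (D : HessianEigen K R)
    (f : Fin T → E n) (ω : Fin T → Coin n) (t : Fin T) (c : Coin n) :
    iterate η D f (Function.update ω t c) t = iterate η D f ω t := by
  rw [iterate, iterate, estimateSum_update η D f ω t c t le_rfl]

lemma estimateSum_succ_sub {n T : ℕ} {K : Set (E n)} {R : E n → ℝ} (η : ℝ) (D : HessianEigen K R)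
    (f : Fin T → E n) (ω : Fin T → Coin n) (t : Fin T) :
    estimateSum η D f ω (t + 1) - estimateSum η D f ω t =
      guess D (f t) (iterate η D f ω t) (ω t) := by
  rw [estimateSum, dif_pos t.2, add_sub_cancel_left, iterate]

/-! ### Regret of FTRL for a fixed sequence of losses -/

namespace IsSelfConcordantBarrier

variable {n : ℕ} {ϑ η : ℝ} {K : Set (E n)} {R : E n → ℝ}

/-- Follow the leader, be the leader. -/
lemma sum_inner_ftrl_succ_le (hR : IsSelfConcordantBarrier ϑ K R) (hK : IsCompact K)
    (hKint : (interior K).Nonempty) {S : ℕ → E n} (hS : S 0 = 0) (T : ℕ) :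
    η * ∑ k ∈ Finset.range T, inner ℝ (S (k + 1) - S k) (ftrl η K R (S (k + 1)))
      + R (ftrl η K R (S 0)) ≤ ftrlObjective η R (S T) (ftrl η K R (S T)) := by
  induction T with
  | zero => simp [ftrlObjective, hS]
  | succ T ih =>
    -- The old minimizer is tested against the new one in the old objective.
    have h1 := (hR.ftrl_spec hK hKint η (S T)).2 (hR.ftrl_spec hK hKint η (S (T + 1))).1
    have h2 : ftrlObjective η R (S (T + 1)) (ftrl η K R (S (T + 1))) =
        ftrlObjective η R (S T) (ftrl η K R (S (T + 1)))
          + η * inner ℝ (S (T + 1) - S T) (ftrl η K R (S (T + 1))) := by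
      simp only [ftrlObjective, inner_sub_left]; ring
    rw [Finset.sum_range_succ, mul_add, h2]
    simp only [mem_ofPred_eq] at h1
    linarith

/-- Regret of FTRL with a self-concordant barrier on linear losses. -/
lemma ftrl_regret_le (hR : IsSelfConcordantBarrier ϑ K R) (hK : IsCompact K)
    (hKconv : Convex ℝ K) (hKint : (interior K).Nonempty) (hη : 0 ≤ η) {S : ℕ → E n}
    (hS : S 0 = 0) {T : ℕ} {C : ℝ} (hC : 0 ≤ C) (hηC : η * C ≤ 1 / 2)
    (hg : ∀ k < T, ∀ h, inner ℝ (S (k + 1) - S k) h ≤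
      C * Real.sqrt (quad R (ftrl η K R (S k)) h)) {u : E n} (hu : u ∈ interior K) :
    η * ∑ k ∈ Finset.range T, inner ℝ (S (k + 1) - S k) (ftrl η K R (S k) - u) ≤
      η * (T * (2 * η * C ^ 2)) + (R u - R (ftrl η K R (S 0))) := by
  have h1 := (hR.sum_inner_ftrl_succ_le (η := η) hK hKint hS T).trans
    ((hR.ftrl_spec hK hKint η (S T)).2 hu)
  -- The price of playing the current leader instead of the next one, by stability.
  have h2 : ∑ k ∈ Finset.range T,
      inner ℝ (S (k + 1) - S k) (ftrl η K R (S k) - ftrl η K R (S (k + 1))) ≤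
      T * (2 * η * C ^ 2) := by
    have := Finset.sum_le_card_nsmul (Finset.range T) (fun k =>
      (inner ℝ (S (k + 1) - S k) (ftrl η K R (S k) - ftrl η K R (S (k + 1))) : ℝ))
      (2 * η * C ^ 2) fun k hk => by
        obtain ⟨hx, hxm⟩ := hR.ftrl_spec hK hKint η (S k)
        obtain ⟨hy, hym⟩ := hR.ftrl_spec hK hKint η (S (k + 1))
        exact hR.inner_sub_le_of_isMinOn hK.isBounded hKconv hη hx hxm hy
          (by rwa [add_sub_cancel]) (hg k (Finset.mem_range.1 hk)) hC hηC
    simpa using this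
  have h3 : ∑ k ∈ Finset.range T, inner ℝ (S (k + 1) - S k) u = inner ℝ (S T) u := by
    rw [← sum_inner, Finset.sum_range_sub, hS, sub_zero]
  have h4 := mul_le_mul_of_nonneg_left h2 hη
  simp only [ftrlObjective] at h1
  simp only [inner_sub_right, Finset.sum_sub_distrib] at h3 h4 ⊢
  rw [mul_sub] at h4 ⊢
  rw [h3]
  linarith

lemma shrink_mem_interior {x u : E n} (hKconv : Convex ℝ K) (hx : x ∈ interior K) (hu : u ∈ K) :
    ∀ s ∈ Ico (0 : ℝ) 1, x + s • (u - x) ∈ interior K := fun s hs => by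
  have := hKconv.add_smul_sub_mem_interior hu hx (t := 1 - s) ⟨by linarith [hs.2], by linarith [hs.1]⟩
  convert this using 1
  module

end IsSelfConcordantBarrier

/-! ### Reduction to FTRL and the final bound -/

/-- The expected regret is the expected regret of FTRL on the estimated losses. -/
lemma expectedRegret_eq {n T : ℕ} {η : ℝ} {K : Set (E n)} {R : E n → ℝ} (hn : 1 ≤ n)
    (D : HessianEigen K R) (f : Fin T → E n)
    (hpos : ∀ ω t i, 0 < D.val (iterate η D f ω t) i) (u v : E n) :
    expectedRegret η D f u =
      (Finset.expect Finset.univ fun ω : Fin T → Coin n =>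
        ∑ t, inner ℝ (guess D (f t) (iterate η D f ω t) (ω t)) (iterate η D f ω t - v))
      + ∑ t, inner ℝ (f t) (v - u) := by
  have : NeZero n := ⟨by omega⟩
  have hG : ∀ t : Fin T, (Finset.expect Finset.univ fun ω : Fin T → Coin n =>
      (inner ℝ (f t) (sample D (iterate η D f ω t) (ω t))
        - inner ℝ (guess D (f t) (iterate η D f ω t) (ω t)) (iterate η D f ω t - v) : ℝ)) =
      inner ℝ (f t) v := fun t => by
    rw [expect_apply_coord t (fun ω c => inner ℝ (f t) (sample D (iterate η D f ω t) c)
        - inner ℝ (guess D (f t) (iterate η D f ω t) c) (iterate η D f ω t - v))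
      fun ω c d => by simp only [iterate_update]]
    simp only [expect_inner_sample_sub_inner_guess hn D (hpos _ t), Fintype.expect_const]
  have hsum := Finset.sum_congr rfl fun (t : Fin T) (_ : t ∈ Finset.univ) => hG t
  rw [← Finset.expect_sum_comm] at hsum
  simp only [Finset.sum_sub_distrib, Finset.expect_sub_distrib, inner_sub_right (𝕜 := ℝ) (f _)]
    at hsum ⊢
  simp only [expectedRegret, regret, prediction, Finset.expect_sub_distrib, Fintype.expect_const]
  linarith

end Scrible

end

theorem mainTheorem1 {n T : ℕ} (hn : 1 ≤ n) (hT : 2 ≤ T)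
    {K : Set (Scrible.E n)} (hKc : IsCompact K) (hKconv : Convex ℝ K) (hKint : (interior K).Nonempty)
    {R : Scrible.E n → ℝ} {ϑ : ℝ} (hR : Scrible.IsSelfConcordantBarrier ϑ K R)
    (D : Scrible.HessianEigen K R)
    (f : Fin T → Scrible.E n) {L : ℝ} (hL : 0 < L)
    (hf : ∀ t, ∀ x ∈ K, |inner ℝ (f t) x| ≤ L)
    {η : ℝ} (hη : η = Real.sqrt (ϑ * Real.log T / (2 * (n : ℝ) ^ 2 * L ^ 2 * T)))
    (hTϑ : (T : ℝ) / Real.log T > 8 * ϑ) :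
    (∀ (ω : Fin T → Scrible.Coin n) (t : Fin T),
      Scrible.iterate η D f ω t ∈ interior K ∧
      (∀ z ∈ interior K, z ≠ Scrible.iterate η D f ω t →
        Scrible.ftrlObjective η R (Scrible.estimateSum η D f ω t) (Scrible.iterate η D f ω t)
          < Scrible.ftrlObjective η R (Scrible.estimateSum η D f ω t) z) ∧
      (∀ i, 0 < D.val (Scrible.iterate η D f ω t) i) ∧
      Scrible.prediction η D f ω t ∈ K) ∧
    ∀ u ∈ K, Scrible.expectedRegret η D f u
      ≤ n * L * Real.sqrt (8 * ϑ * T * Real.log T) + 2 * L := by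
  have hit : ∀ ω t, Scrible.iterate η D f ω t ∈ interior K := fun ω t =>
    (hR.ftrl_spec hKc hKint η _).1
  have hpos : ∀ ω t i, 0 < D.val (Scrible.iterate η D f ω t) i := fun ω t =>
    hR.val_pos hKc.isBounded D (hit ω t)
  refine ⟨fun ω t => ⟨hit ω t, fun z hz hne => hR.ftrlObjective_lt hKc.isBounded hKconv (hit ω t)
    (hR.ftrl_spec hKc hKint η _).2 hz hne, hpos ω t, hR.sample_mem hKc D (hit ω t) _⟩,
    fun u hu => ?_⟩
  have hϑ : 0 < ϑ := hR.parameter_pos hn hKc.isBounded hKint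
  have hT0 : (0 : ℝ) < T := by positivity
  have hT1 : (1 : ℝ) < T := by exact_mod_cast hT
  have hlog : 0 < Real.log T := Real.log_pos hT1
  have hn0 : (0 : ℝ) < n := by exact_mod_cast hn
  set C : ℝ := n * L with hC_def
  have hC : 0 < C := by positivity
  have hη0 : 0 < η := by rw [hη]; positivity
  -- This identity says that `η` equates the total stability cost with the barrier cost, both
  -- multiplied by `η`.
  have hη2 : 2 * η ^ 2 * C ^ 2 * T = ϑ * Real.log T := by
    rw [hη, Real.sq_sqrt (by positivity), hC_def]
    field_simp
  have hsqrt : Real.sqrt (8 * ϑ * T * Real.log T) = 4 * η * C * T := by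
    rw [Real.sqrt_eq_iff_mul_self_eq (by positivity) (by positivity)]
    linear_combination (-(8 * T)) * hη2
  -- The condition on `T` even gives `ηC < 1/4`.
  have hηC : η * C ≤ 1 / 2 := by
    rw [gt_iff_lt, lt_div_iff₀ hlog] at hTϑ
    have h1 : (η * C) ^ 2 * 16 < 1 := by
      by_contra! hcon
      nlinarith
    nlinarith [mul_pos hη0 hC]
  set x₁ := Scrible.ftrl η K R 0
  have hx₁ : x₁ ∈ interior K := (hR.ftrl_spec hKc hKint η 0).1
  have hs : 1 - (T : ℝ)⁻¹ ∈ Set.Ico (0 : ℝ) 1 :=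
    ⟨sub_nonneg.2 (inv_le_one_of_one_le₀ hT1.le), sub_lt_self _ (by positivity)⟩
  have hin := Scrible.IsSelfConcordantBarrier.shrink_mem_interior hKconv hx₁ hu
  -- The barrier may be infinite at `u`, so `v` replaces it; the remaining fraction `1/T` produces
  -- the `log T`.
  set v := x₁ + (1 - (T : ℝ)⁻¹) • (u - x₁) with hv_def
  have hv : v ∈ interior K := hin _ hs
  have hRv : R v - R x₁ ≤ ϑ * Real.log T := by
    have := hR.sub_le_neg_mul_log hϑ hin hs
    rwa [sub_sub_cancel, Real.log_inv, neg_mul_neg] at this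
  have hvu : ∑ t, inner ℝ (f t) (v - u) ≤ 2 * L := by
    have hle : ∀ t ∈ Finset.univ, inner ℝ (f t) (v - u) ≤ (T : ℝ)⁻¹ * (2 * L) := fun t _ => by
      have h1 : v - u = (T : ℝ)⁻¹ • (x₁ - u) := by rw [hv_def]; module
      rw [h1, real_inner_smul_right, inner_sub_right]
      have h2 := (abs_le.1 (hf t _ (interior_subset hx₁))).2
      have h3 := (abs_le.1 (hf t _ hu)).1
      gcongr
      linarith
    refine (Finset.sum_le_card_nsmul _ _ _ hle).trans (le_of_eq ?_)
    rw [Finset.card_univ, Fintype.card_fin, nsmul_eq_mul, mul_inv_cancel_left₀ hT0.ne']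
  rw [Scrible.expectedRegret_eq hn D f hpos u v]
  refine add_le_add ?_ hvu
  have : NeZero n := ⟨by omega⟩
  -- After the reduction, the bound holds for every outcome of the coins.
  refine Finset.expect_le Finset.univ_nonempty fun ω _ => ?_
  have hreg := hR.ftrl_regret_le hKc hKconv hKint hη0.le (S := Scrible.estimateSum η D f ω) rfl
    hC.le hηC (fun k hk h => by
      have := Scrible.estimateSum_succ_sub η D f ω ⟨k, hk⟩
      simp only at this
      rw [this]
      exact hR.inner_guess_le hKc D (hit ω ⟨k, hk⟩) (hf _) _ h) hv
  rw [Finset.sum_range] at hreg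
  simp only [Scrible.estimateSum_succ_sub] at hreg
  refine le_of_mul_le_mul_left (hreg.trans ?_) hη0
  rw [hsqrt]
  change _ + (R v - R x₁) ≤ _
  -- By `hη2` and `hRv`, the two costs sum to at most `4η²C²T`, which is `η` times the target.
  nlinarith
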